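/- Let $G$ be a simple graph with $n \ge 3$ vertices, labelled by $\mathbf n = \{1,\dots,n\}$, with adjacency matrix $(a_{ij})$, and let $H_c$ be the number of Hamiltonian cycles of $G$ (counted as subgraphs, i.e. without a starting point or a direction). For real variables $t, t_1,\dots,t_n$ put $D_i=\sum_{j=1}^n a_{ij}t_j$, and let $\mathbf K(t,t_1,\dots,t_n)$ be the $n\times n$ matrix with diagonal entries $D_i t$ and off-diagonal entries $-a_{ij}t_j$ ($i\ne j$). Let $$D(t_1,\dots,t_n)=\frac{\partial}{\partial t}\det\mathbf K(t,t_1,\dots,t_n)\Big|_{t=1},$$ and for $0\le l\le n$ let $D^{(l)}=\sum_{I_l} D(t_1,\dots,t_n)$, where the sum runs over all $l$-element subsets $I_l\subseteq\mathbf n$, and where in the summand of $I_l$ the variables take the values $t_i=0$ for $i\in I_l$ and $t_i=1$ for $i\notin I_l$. Then $$H_c=\frac1{2n}\sum_{l=0}^n(-1)^l D^{(l)}.$$ Moreover, if $G$ is instead a digraph without loops on $n\ge 1$ vertices (arcs in both directions between two vertices are allowed), with $a_{ij}=1$ if there is an arc from $i$ to $j$ and $a_{ij}=0$ otherwise, and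 if $D^{(l)}$ is formed from this matrix $(a_{ij})$ in the same way, then the number of directed Hamiltonian cycles of $G$ (cyclic arrangements of all the vertices with an arc from each vertex to the next; for $n=2$ this is a pair of opposite arcs) is $$\frac1n\sum_{l=0}^n(-1)^l D^{(l)}.$$ -/

import Mathlib

namespace HamiltonianEnumeration

/-- The weighted out-degree `D_i = ∑_j a_{ij} t_j`. -/
def weightedDegree {V : Type*} [Fintype V] (A : Matrix V V ℝ) (x : V → ℝ) (i : V) : ℝ :=
  ∑ j, A i j * x j

/-- The matrix `K(t, t_1, …, t_n)`, with the variables `t_i` given by `x : V → ℝ`: its diagonal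
entries are `D_i t` and its off-diagonal entries are `-a_{ij} t_j`. -/
def kirchhoffMatrix {V : Type*} [Fintype V] [DecidableEq V] (A : Matrix V V ℝ) (t : ℝ)
    (x : V → ℝ) : Matrix V V ℝ :=
  Matrix.of fun i j => if i = j then weightedDegree A x i * t else -(A i j * x j)

/-- `D(t_1, …, t_n)`, the derivative of `det K(t, t_1, …, t_n)` in `t` at `t = 1`. -/
noncomputable def detDeriv {V : Type*} [Fintype V] [DecidableEq V] (A : Matrix V V ℝ)
    (x : V → ℝ) : ℝ :=
  deriv (fun t : ℝ => (kirchhoffMatrix A t x).det) 1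

/-- `D_l`: the sum over all `l`-element sets `I` of vertices of the value of `D(t_1, …, t_n)` at
`t_i = 0` for `i ∈ I` and `t_i = 1` for `i ∉ I`. -/
noncomputable def detDerivSum {V : Type*} [Fintype V] [DecidableEq V] (A : Matrix V V ℝ)
    (l : ℕ) : ℝ :=
  ∑ I ∈ (Finset.univ : Finset V).powersetCard l, detDeriv A fun i => if i ∈ I then 0 else 1

/-- The Hamiltonian cycles of a simple graph, each given by its set of edges, so that walks
that differ by the starting point or the direction are one cycle. -/
def hamiltonianCycles {V : Type*} [DecidableEq V] (G : SimpleGraph V) : Set (Set (Sym2 V)) :=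
  {E | ∃ (v : V) (w : G.Walk v v), w.IsHamiltonianCycle ∧ E = {e | e ∈ w.edges}}

/-- The number `H_c` of Hamiltonian cycles of a simple graph. -/
noncomputable def numHamiltonianCycles {V : Type*} [DecidableEq V] (G : SimpleGraph V) : ℕ :=
  (hamiltonianCycles G).ncard

/-- The directed Hamiltonian cycles of a digraph, each given by its set of arcs: list all the
vertices as `u 0, …, u (n - 1)`, each exactly once, so that there is an arc from every vertex of
the list to the next one, and from the last one to the first (`finRotate n` is the cyclic
successor on `Fin n`). Listings that differ by a rotation are one cycle. -/
def directedHamiltonianCycles {V : Type*} [Fintype V] (G : Digraph V) : Set (Set (V × V)) :=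
  {E | ∃ u : Fin (Fintype.card V) ≃ V,
    (∀ i, G.Adj (u i) (u (finRotate _ i))) ∧ E = Set.range fun i => (u i, u (finRotate _ i))}

/-- The number of directed Hamiltonian cycles of a digraph. -/
noncomputable def numDirectedHamiltonianCycles {V : Type*} [Fintype V] (G : Digraph V) : ℕ :=
  (directedHamiltonianCycles G).ncard

/-- The adjacency matrix of a digraph: `a_{ij} = 1` if there is an arc from `i` to `j`, and
`a_{ij} = 0` otherwise. -/
def digraphAdjMatrix {V : Type*} (G : Digraph V) [DecidableRel G.Adj] : Matrix V V ℝ :=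
  Matrix.of fun i j => if G.Adj i j then 1 else 0

end HamiltonianEnumeration

/-! Put `W i j = a_{ij} t_j`. Row `i` of `K` is `∑_j W i j (t e_i - e_j)`, so `det K` is the sum
over all maps `f` of the vertices of `∏_i W i (f i)` times the characteristic polynomial at `t` of
the `0`-`1` matrix of `f`. The alternating sum over the `0`-`1` values of the variables cancels
every `f` that is not a permutation. The characteristic polynomial of the permutation matrix of `π`
has one factor that vanishes at `1` for each cycle of `π`, so its derivative at `1` vanishes unless
`π` is a single `n`-cycle, when the polynomial is `X ^ n - 1` and the derivative is `n`. What is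
left is `n` times the number of cyclic permutations along arcs, that is, of directed Hamiltonian
cycles; an undirected Hamiltonian cycle on at least three vertices is a pair of mutually inverse
ones. -/

namespace HamiltonianEnumeration

open Equiv Polynomial

section Determinant

variable {V R : Type*} [Fintype V] [DecidableEq V] [CommRing R]

theorem det_smul_diagonal_rowSum_sub (W : Matrix V V R) (t : R) :
    (t • Matrix.diagonal (fun i => ∑ j, W i j) - W).det =
      ∑ f : V → V, (∏ i, W i (f i)) * ((1 : Matrix V V R).submatrix f id).charpoly.eval t := by
  have row_eq_sum : t • Matrix.diagonal (fun i => ∑ j, W i j) - W =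
      fun i => ∑ j, W i j • (Matrix.scalar V t i - (1 : Matrix V V R) j) := by
    ext i k
    simp [Matrix.diagonal_apply, Matrix.one_apply, mul_sub, Finset.sum_mul, mul_comm t]
  calc (t • Matrix.diagonal (fun i => ∑ j, W i j) - W).det
      = ∑ f : V → V, Matrix.detRowAlternating
          fun i => W i (f i) • (Matrix.scalar V t i - (1 : Matrix V V R) (f i)) := by
        rw [row_eq_sum]
        exact Matrix.detRowAlternating.toMultilinearMap.map_sum _
    _ = _ := Finset.sum_congr rfl fun f _ => by
        rw [Matrix.eval_charpoly]
        exact Matrix.detRowAlternating.toMultilinearMap.map_smul_univ _ _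

theorem det_kirchhoffMatrix {A : Matrix V V ℝ} (hA : ∀ i, A i i = 0) (t : ℝ) (x : V → ℝ) :
    (kirchhoffMatrix A t x).det = ∑ f : V → V,
      (∏ i, A i (f i) * x (f i)) * ((1 : Matrix V V ℝ).submatrix f id).charpoly.eval t := by
  set W : Matrix V V ℝ := Matrix.of fun i j => A i j * x j with hW
  have kirchhoffMatrix_eq :
      kirchhoffMatrix A t x = t • Matrix.diagonal (fun i => ∑ j, W i j) - W := by
    ext i j
    obtain rfl | hij := eq_or_ne i j
    · simp [W, kirchhoffMatrix, weightedDegree, hA, mul_comm t]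
    · simp [W, kirchhoffMatrix, hij]
  rw [kirchhoffMatrix_eq, det_smul_diagonal_rowSum_sub]
  simp only [hW, Matrix.of_apply]

theorem detDeriv_eq_sum {A : Matrix V V ℝ} (hA : ∀ i, A i i = 0) (x : V → ℝ) :
    detDeriv A x = ∑ f : V → V, (∏ i, A i (f i) * x (f i)) *
      ((1 : Matrix V V ℝ).submatrix f id).charpoly.derivative.eval 1 := by
  simp only [detDeriv, det_kirchhoffMatrix hA]
  exact (HasDerivAt.fun_sum fun f _ => (Polynomial.hasDerivAt _ 1).const_mul _).deriv

end Determinant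

section InclusionExclusion

theorem sum_neg_one_pow_card_mul_prod_ite_mem {ι V R : Type*} [Fintype ι] [Fintype V]
    [DecidableEq V] [CommRing R] (f : ι → V) [Decidable f.Surjective] :
    ∑ I : Finset V, (-1 : R) ^ I.card * ∏ i, (if f i ∈ I then 0 else 1) =
      if f.Surjective then 1 else 0 := by
  have compl_image_eq_empty : (Finset.univ.image f)ᶜ = ∅ ↔ f.Surjective := by
    simp [Finset.eq_univ_iff_forall, Function.Surjective]
  have prod_eq (I : Finset V) : ∏ i, (if f i ∈ I then 0 else 1 : R) =
      if I ∈ (Finset.univ.image f)ᶜ.powerset then 1 else 0 := by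
    simp_rw [← ite_not (_ ∈ I), Fintype.prod_boole]
    refine if_congr ?_ rfl rfl
    rw [Finset.mem_powerset, Finset.subset_compl_comm, Finset.image_subset_iff]
    simp
  calc ∑ I : Finset V, (-1 : R) ^ I.card * ∏ i, (if f i ∈ I then 0 else 1)
      = ∑ I ∈ (Finset.univ.image f)ᶜ.powerset, (-1 : R) ^ I.card := by
        simp only [prod_eq, mul_ite, mul_one, mul_zero, Finset.sum_ite_mem, Finset.univ_inter]
    _ = ((∑ I ∈ (Finset.univ.image f)ᶜ.powerset, (-1) ^ I.card : ℤ) : R) := by push_cast; rfl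
    _ = if f.Surjective then 1 else 0 := by
        simp [Finset.sum_powerset_neg_one_pow_card, compl_image_eq_empty,
          -Finset.compl_eq_empty_iff]

theorem sum_ite_surjective_eq_sum_perm {V M : Type*} [Fintype V] [DecidableEq V] [AddCommMonoid M]
    [DecidablePred (Function.Surjective : (V → V) → Prop)] (g : (V → V) → M) :
    ∑ f, (if f.Surjective then g f else 0) = ∑ π : Perm V, g π := by
  refine (Fintype.sum_of_injective (fun π : Perm V => (π : V → V)) DFunLike.coe_injective
    (fun π => g π) (fun f => if f.Surjective then g f else 0)
    (fun f hf => if_neg fun hsurj => hf ?_) fun π => (if_pos π.surjective).symm).symm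
  exact ⟨.ofBijective f (Finite.surjective_iff_bijective.1 hsurj), rfl⟩

end InclusionExclusion

section CyclicPerm

variable {V : Type*} {π τ : Perm V}

theorem forall_of_isCycleOn_univ [Finite V] (hπ : π.IsCycleOn Set.univ) {p : V → Prop} {v : V}
    (hv : p v) (hstep : ∀ w, p w → p (π w)) (w : V) : p w := by
  obtain ⟨k, rfl⟩ := hπ.exists_pow_eq' Set.finite_univ (Set.mem_univ v) (Set.mem_univ w)
  induction k with
  | zero => exact hv
  | succ k ih =>
    rw [pow_succ', Perm.mul_apply]
    exact hstep _ ih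

theorem eq_one_or_eq_of_forall_apply_eq_or [Finite V] (hπ : π.IsCycleOn Set.univ)
    (hτ : ∀ v, τ v = v ∨ τ v = π v) : τ = 1 ∨ τ = π := by
  cases subsingleton_or_nontrivial V
  · exact .inl (Subsingleton.elim _ _)
  refine or_iff_not_imp_left.2 fun hne => ?_
  obtain ⟨v, hv⟩ : ∃ v, τ v ≠ v := by simpa [Perm.ext_iff] using hne
  refine Perm.ext (forall_of_isCycleOn_univ hπ ((hτ v).resolve_left hv) fun w hw => ?_)
  exact (hτ _).resolve_left fun hfix =>
    hπ.apply_ne Set.nontrivial_univ (Set.mem_univ w) (τ.injective (hfix.trans hw.symm))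

theorem apply_apply_ne_of_isCycleOn_univ [Fintype V] (hπ : π.IsCycleOn Set.univ)
    (hcard : 3 ≤ Fintype.card V) (v : V) : π (π v) ≠ v := fun h => by
  have hdvd : Fintype.card V ∣ 2 := by
    rw [← Finset.coe_univ] at hπ
    exact (hπ.pow_apply_eq (Finset.mem_univ v)).1 h
  have := Nat.le_of_dvd two_pos hdvd
  omega

theorem isCycleOn_univ_finRotate (n : ℕ) : (finRotate n).IsCycleOn Set.univ := by
  obtain hn | hn := le_or_gt 2 n
  · have hsupport : {i | finRotate n i ≠ i} = Set.univ := by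
      simpa [Set.ext_iff, Finset.ext_iff] using support_finRotate_of_le hn
    exact hsupport ▸ (isCycle_finRotate_of_le hn).isCycleOn
  · have := Fin.subsingleton_iff_le_one.2 (Nat.le_of_lt_succ hn)
    exact Perm.isCycleOn_of_subsingleton _ _

theorem isCycleOn_univ_permCongr {W : Type*} (e : V ≃ W) (hπ : π.IsCycleOn Set.univ) :
    (e.permCongr π).IsCycleOn Set.univ := by
  refine ⟨Set.bijOn_univ.2 (e.permCongr π).bijective, fun x _ y _ => ?_⟩
  obtain ⟨k, hk⟩ := hπ.2 (Set.mem_univ (e.symm x)) (Set.mem_univ (e.symm y))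
  refine ⟨k, ?_⟩
  have hpow : e.permCongr π ^ k = e.permCongr (π ^ k) := (map_zpow e.permCongrHom π k).symm
  simp [hpow, hk]

theorem support_eq_univ_of_isCycleOn_univ [Fintype V] [DecidableEq V] [Nontrivial V]
    (hπ : π.IsCycleOn Set.univ) : π.support = Finset.univ :=
  Finset.eq_univ_iff_forall.2 fun v =>
    Perm.mem_support.2 (hπ.apply_ne Set.nontrivial_univ (Set.mem_univ v))

theorem isCycle_of_isCycleOn_univ [Nontrivial V] (hπ : π.IsCycleOn Set.univ) : π.IsCycle :=
  Perm.isCycle_iff_exists_isCycleOn.2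
    ⟨Set.univ, Set.nontrivial_univ, hπ, fun _ _ => Set.mem_univ _⟩

theorem isConj_of_isCycleOn_univ [Finite V] (hπ : π.IsCycleOn Set.univ)
    (hτ : τ.IsCycleOn Set.univ) : IsConj π τ := by
  classical
  have := Fintype.ofFinite V
  cases subsingleton_or_nontrivial V
  · exact Subsingleton.elim π τ ▸ IsConj.refl π
  · refine (isCycle_of_isCycleOn_univ hπ).isConj (isCycle_of_isCycleOn_univ hτ) ?_
    rw [support_eq_univ_of_isCycleOn_univ hπ, support_eq_univ_of_isCycleOn_univ hτ]

theorem isCycleOn_univ_iff_exists_permCongr_finRotate [Fintype V] :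
    π.IsCycleOn Set.univ ↔ ∃ u : Fin (Fintype.card V) ≃ V, u.permCongr (finRotate _) = π := by
  have isCycleOn_permCongr (u : Fin (Fintype.card V) ≃ V) :
      (u.permCongr (finRotate _)).IsCycleOn Set.univ :=
    isCycleOn_univ_permCongr u (isCycleOn_univ_finRotate _)
  refine ⟨fun hπ => ?_, fun ⟨u, hu⟩ => hu ▸ isCycleOn_permCongr u⟩
  obtain ⟨u⟩ := Fintype.card_eq.1 (Fintype.card_fin (Fintype.card V))
  obtain ⟨c, hc⟩ := isConj_iff.1 (isConj_of_isCycleOn_univ (isCycleOn_permCongr u) hπ)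
  exact ⟨u.trans c, hc⟩

end CyclicPerm

section PermMatrix

variable {V R : Type*} [Fintype V] [DecidableEq V] [CommRing R] {π : Perm V}

theorem eval_one_charpoly_permMatrix [Nonempty V] (π : Perm V) :
    (π.permMatrix R).charpoly.eval 1 = 0 := by
  rw [Matrix.eval_charpoly]
  set M := Matrix.scalar V (1 : R) - π.permMatrix R
  have hM : M.mulVec 1 = 0 := by
    simp [M, Matrix.sub_mulVec, PEquiv.toMatrix_toPEquiv_mulVec, Pi.one_comp]
  have hdet : M.det • (1 : V → R) = 0 := by
    rw [← Matrix.one_mulVec (M.det • 1), Matrix.mulVec_smul, ← Matrix.smul_mulVec,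
      ← Matrix.adjugate_mul, ← Matrix.mulVec_mulVec, hM, Matrix.mulVec_zero]
  simpa using congrFun hdet (Classical.arbitrary V)

theorem charpoly_permMatrix_eq_mul {p : V → Prop} [DecidablePred p] (hp : ∀ v, p (π v) ↔ p v) :
    (π.permMatrix R).charpoly = ((π.subtypePerm hp).permMatrix R).charpoly *
      ((π.subtypePerm (p := fun v => ¬ p v) fun v => not_congr (hp v)).permMatrix R).charpoly := by
  have hblock : ∀ v, ¬ p v → ∀ w, p w → (π.permMatrix R).charmatrix v w = 0 := fun v hv w hw => by
    have hvw : v ≠ w := fun h => hv (h ▸ hw)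
    have hπvw : π v ≠ w := fun h => hv ((hp v).1 (h ▸ hw))
    simp [Matrix.charmatrix_apply_ne _ _ _ hvw, hπvw]
  rw [Matrix.charpoly, Matrix.twoBlockTriangular_det _ p hblock]
  congr 2 <;> ext v w <;>
    simp [Matrix.toSquareBlockProp, Matrix.charmatrix_apply, Matrix.diagonal_apply,
      Subtype.ext_iff]

theorem charpoly_permMatrix_of_isCycleOn_univ [Nonempty V] (hπ : π.IsCycleOn Set.univ) :
    (π.permMatrix R).charpoly = X ^ Fintype.card V - 1 := by
  cases subsingleton_or_nontrivial V
  · have := uniqueOfSubsingleton (Classical.arbitrary V)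
    simp [Subsingleton.elim π 1, Matrix.charpoly_one]
  have hπ_ne (v : V) : π v ≠ v := hπ.apply_ne Set.nontrivial_univ (Set.mem_univ v)
  have charmatrix_self (v : V) : (π.permMatrix R).charmatrix v v = X := by
    simp [Matrix.charmatrix_apply_eq, hπ_ne]
  have charmatrix_of_ne {v w : V} (h : w ≠ v) :
      (π.permMatrix R).charmatrix v w = if π v = w then -1 else 0 := by
    rw [Matrix.charmatrix_apply_ne _ _ _ h.symm]
    split_ifs with hw <;> simp [hw]
  have prod_eq_zero (τ : Perm V) (hτ : τ ≠ 1 ∧ τ ≠ π) :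
      ∏ v, (π.permMatrix R).charmatrix v (τ v) = 0 := by
    obtain ⟨v, hv⟩ : ∃ v, ¬ (τ v = v ∨ τ v = π v) := by
      by_contra! h
      exact (eq_one_or_eq_of_forall_apply_eq_or hπ h).elim hτ.1 hτ.2
    obtain ⟨hv_one, hv_π⟩ := not_or.1 hv
    exact Finset.prod_eq_zero (Finset.mem_univ v) <| by
      rw [charmatrix_of_ne hv_one, if_neg (Ne.symm hv_π)]
  have one_ne : 1 ≠ π := fun h => hπ_ne (Classical.arbitrary V) (h ▸ rfl)
  rw [Matrix.charpoly, ← Matrix.det_transpose, Matrix.det_apply']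
  simp only [Matrix.transpose_apply]
  rw [Fintype.sum_eq_add 1 π one_ne fun τ hτ => by rw [prod_eq_zero τ hτ, mul_zero]]
  simp only [Perm.sign_one, Perm.one_apply, charmatrix_self, charmatrix_of_ne (hπ_ne _),
    (isCycle_of_isCycleOn_univ hπ).sign, support_eq_univ_of_isCycleOn_univ hπ]
  simp [← mul_pow, sub_eq_add_neg]

theorem eval_one_derivative_charpoly_permMatrix [Decidable (π.IsCycleOn Set.univ)] :
    (π.permMatrix R).charpoly.derivative.eval 1 =
      if π.IsCycleOn Set.univ then (Fintype.card V : R) else 0 := by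
  classical
  cases isEmpty_or_nonempty V
  · simp [Matrix.charpoly, Matrix.det_isEmpty]
  split_ifs with hπ
  · simp [charpoly_permMatrix_of_isCycleOn_univ hπ, derivative_X_pow]
  · obtain ⟨v, w, hvw⟩ : ∃ v w, ¬ π.SameCycle v w := by
      by_contra! hsame
      exact hπ ⟨Set.bijOn_univ.2 π.bijective, fun v _ w _ => hsame v w⟩
    have : Nonempty {u // π.SameCycle v u} := ⟨v, .refl π v⟩
    have : Nonempty {u // ¬ π.SameCycle v u} := ⟨w, hvw⟩
    rw [charpoly_permMatrix_eq_mul (p := π.SameCycle v) fun u => Perm.sameCycle_apply_right]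
    simp [derivative_mul, eval_one_charpoly_permMatrix]

end PermMatrix

section AlternatingSum

variable {V : Type*} [Fintype V] [DecidableEq V]

theorem sum_range_neg_one_pow_mul_detDerivSum (A : Matrix V V ℝ) :
    ∑ l ∈ Finset.range (Fintype.card V + 1), (-1 : ℝ) ^ l * detDerivSum A l =
      ∑ I : Finset V, (-1 : ℝ) ^ I.card * detDeriv A fun i => if i ∈ I then 0 else 1 := by
  rw [← Finset.powerset_univ, Finset.sum_powerset, Finset.card_univ]
  refine Finset.sum_congr rfl fun l _ => ?_
  rw [detDerivSum, Finset.mul_sum]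
  exact Finset.sum_congr rfl fun I hI => by rw [(Finset.mem_powersetCard.1 hI).2]

theorem alternating_sum_detDerivSum [DecidablePred fun π : Perm V => π.IsCycleOn Set.univ]
    {A : Matrix V V ℝ} (hA : ∀ i, A i i = 0) :
    ∑ l ∈ Finset.range (Fintype.card V + 1), (-1 : ℝ) ^ l * detDerivSum A l =
      Fintype.card V * ∑ π : Perm V with π.IsCycleOn Set.univ, ∏ i, A i (π i) := by
  classical
  set c : (V → V) → ℝ := fun f =>
    (∏ i, A i (f i)) * ((1 : Matrix V V ℝ).submatrix f id).charpoly.derivative.eval 1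
  have c_perm (π : Perm V) :
      c π = if π.IsCycleOn Set.univ then Fintype.card V * ∏ i, A i (π i) else 0 := by
    simp only [c, ← PEquiv.toMatrix_toPEquiv_eq, eval_one_derivative_charpoly_permMatrix, mul_ite,
      mul_zero, mul_comm (Fintype.card V : ℝ)]
  calc ∑ l ∈ Finset.range (Fintype.card V + 1), (-1 : ℝ) ^ l * detDerivSum A l
      = ∑ I : Finset V, ∑ f : V → V,
          ((-1) ^ I.card * ∏ i, if f i ∈ I then 0 else 1) * c f := by
        simp only [sum_range_neg_one_pow_mul_detDerivSum, detDeriv_eq_sum hA, Finset.mul_sum,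
          Finset.prod_mul_distrib, c]
        refine Fintype.sum_congr _ _ fun I => Fintype.sum_congr _ _ fun f => ?_
        ring
    _ = ∑ f : V → V, if f.Surjective then c f else 0 := by
        rw [Finset.sum_comm]
        simp only [← Finset.sum_mul, sum_neg_one_pow_card_mul_prod_ite_mem, ite_mul, one_mul,
          zero_mul]
    _ = Fintype.card V * ∑ π : Perm V with π.IsCycleOn Set.univ, ∏ i, A i (π i) := by
        rw [sum_ite_surjective_eq_sum_perm, Finset.mul_sum, Finset.sum_filter]
        exact Fintype.sum_congr _ _ c_perm

end AlternatingSum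

/-- The cyclic permutations of all the vertices that move every vertex along an arc of the relation
`R`: the successor maps of the directed Hamiltonian cycles of `R`. -/
def hamiltonianPerms {V : Type*} (R : V → V → Prop) : Set (Perm V) :=
  {π | π.IsCycleOn Set.univ ∧ ∀ v, R v (π v)}

section DirectedCycles

variable {V : Type*} [Fintype V]

theorem alternating_sum_detDerivSum_digraphAdjMatrix [DecidableEq V] (G : Digraph V)
    [DecidableRel G.Adj] (hG : ∀ v, ¬ G.Adj v v) :
    ∑ l ∈ Finset.range (Fintype.card V + 1), (-1 : ℝ) ^ l * detDerivSum (digraphAdjMatrix G) l =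
      Fintype.card V * (hamiltonianPerms G.Adj).ncard := by
  classical
  have prod_eq (π : Perm V) :
      ∏ i, digraphAdjMatrix G i (π i) = if ∀ v, G.Adj v (π v) then 1 else 0 :=
    Fintype.prod_boole
  rw [alternating_sum_detDerivSum fun i => if_neg (hG i)]
  simp only [prod_eq]
  rw [Finset.sum_boole, Finset.filter_filter, ← Set.ncard_coe_finset]
  simp [hamiltonianPerms]

/-- `F` is the way in which a cycle records its steps: as arcs or as edges. -/
theorem setOf_exists_finRotate_eq_image {α : Type*} (R : V → V → Prop) (F : V → V → α) :
    {E | ∃ u : Fin (Fintype.card V) ≃ V,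
      (∀ i, R (u i) (u (finRotate _ i))) ∧ E = Set.range fun i => F (u i) (u (finRotate _ i))} =
      (fun π : Perm V => Set.range fun v => F v (π v)) '' hamiltonianPerms R := by
  have range_eq (u : Fin (Fintype.card V) ≃ V) :
      (Set.range fun v => F v (u.permCongr (finRotate _) v)) =
        Set.range fun i => F (u i) (u (finRotate _ i)) := by
    simp [← u.surjective.range_comp, Function.comp_def]
  ext E
  constructor
  · rintro ⟨u, hu, rfl⟩
    refine ⟨_, ⟨isCycleOn_univ_iff_exists_permCongr_finRotate.2 ⟨u, rfl⟩, ?_⟩, range_eq u⟩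
    simpa [u.surjective.forall] using hu
  · rintro ⟨π, ⟨hπ, hR⟩, rfl⟩
    obtain ⟨u, rfl⟩ := isCycleOn_univ_iff_exists_permCongr_finRotate.1 hπ
    exact ⟨u, by simpa [u.surjective.forall] using hR, range_eq u⟩

theorem numDirectedHamiltonianCycles_eq_ncard (G : Digraph V) :
    numDirectedHamiltonianCycles G = (hamiltonianPerms G.Adj).ncard := by
  have image_eq := setOf_exists_finRotate_eq_image G.Adj Prod.mk
  rw [numDirectedHamiltonianCycles, directedHamiltonianCycles, image_eq]
  refine Set.ncard_image_of_injective _ fun π τ h => DFunLike.coe_injective ?_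
  simpa only [← Set.graphOn_univ_eq_range, Set.graphOn_univ_inj] using h

end DirectedCycles

/-- The unordered pairs `{v, π v}`: for a successor map `π` of a directed Hamiltonian cycle, the
edge set of the underlying undirected cycle. -/
def permEdges {V : Type*} (π : Perm V) : Set (Sym2 V) :=
  Set.range fun v => s(v, π v)

section PermEdges

variable {V : Type*} {π ρ : Perm V}

theorem permEdges_inv (π : Perm V) : permEdges π⁻¹ = permEdges π := by
  rw [permEdges, ← π.surjective.range_comp]
  exact congrArg Set.range (funext fun v => by simp [Sym2.eq_swap])

theorem eq_or_apply_eq_of_permEdges_subset (h : permEdges π ⊆ permEdges ρ) (v : V) :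
    π v = ρ v ∨ ρ (π v) = v := by
  obtain ⟨w, hw⟩ := h ⟨v, rfl⟩
  obtain ⟨rfl, hv⟩ | ⟨rfl, hv⟩ := Sym2.eq_iff.1 hw
  · exact .inl hv.symm
  · exact .inr hv

variable [Fintype V]

theorem eq_of_permEdges_subset (hcard : 3 ≤ Fintype.card V) (hπ : π.IsCycleOn Set.univ)
    (h : permEdges π ⊆ permEdges ρ) {v : V} (hv : π v = ρ v) : π = ρ :=
  Perm.ext <| forall_of_isCycleOn_univ hπ hv fun w hw =>
    (eq_or_apply_eq_of_permEdges_subset h (π w)).resolve_right fun hback =>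
      apply_apply_ne_of_isCycleOn_univ hπ hcard w (ρ.injective (hback.trans hw))

theorem permEdges_eq_iff (hcard : 3 ≤ Fintype.card V) (hπ : π.IsCycleOn Set.univ) :
    permEdges π = permEdges ρ ↔ ρ = π ∨ ρ = π⁻¹ := by
  refine ⟨fun h => ?_, ?_⟩
  · obtain ⟨v⟩ : Nonempty V := Fintype.card_pos_iff.1 (by omega)
    obtain hv | hv := eq_or_apply_eq_of_permEdges_subset h.subset v
    · exact .inl (eq_of_permEdges_subset hcard hπ h.subset hv).symm
    · refine .inr (inv_eq_iff_eq_inv.1 (eq_of_permEdges_subset hcard hπ ?_ (v := v) ?_).symm)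
      · exact (h.trans (permEdges_inv ρ).symm).subset
      · exact Perm.eq_inv_iff_eq.2 hv
  · rintro (rfl | rfl)
    exacts [rfl, (permEdges_inv π).symm]

end PermEdges

section SimpleGraphCycles

variable {V : Type*} {G : SimpleGraph V}

theorem adjMatrix_eq_digraphAdjMatrix (G : SimpleGraph V) [DecidableRel G.Adj] :
    G.adjMatrix ℝ = digraphAdjMatrix ⟨G.Adj⟩ :=
  rfl

theorem getVert_finRotate {v : V} {w : G.Walk v v} {n : ℕ}
    (hw : w.length = n) (i : Fin n) : w.getVert (finRotate n i) = w.getVert (i + 1) := by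
  obtain _ | n := n
  · exact i.elim0
  rw [coe_finRotate]
  split_ifs with hi
  · rw [hi, Fin.val_last, ← hw, w.getVert_length, w.getVert_zero]
  · rfl

variable [DecidableEq V]

theorem exists_equiv_of_isHamiltonianCycle [Fintype V] {v : V} {w : G.Walk v v}
    (hw : w.IsHamiltonianCycle) :
    ∃ u : Fin (Fintype.card V) ≃ V, (∀ i, G.Adj (u i) (u (finRotate _ i))) ∧
      {e | e ∈ w.edges} = Set.range fun i => s(u i, u (finRotate _ i)) := by
  have hlen := hw.length_eq
  have getVert_injective : Function.Injective fun i : Fin (Fintype.card V) => w.getVert i :=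
    fun i j hij => Fin.ext (hw.isCycle.getVert_injOn' (by simp; omega) (by simp; omega) hij)
  set u : Fin (Fintype.card V) ≃ V := .ofBijective _
    ((Fintype.bijective_iff_injective_and_card _).2 ⟨getVert_injective, Fintype.card_fin _⟩)
  have u_finRotate (i : Fin (Fintype.card V)) : u (finRotate _ i) = w.getVert (i + 1) :=
    getVert_finRotate hlen i
  refine ⟨u, fun i => ?_, Set.ext fun e => ?_⟩
  · rw [u_finRotate]
    exact w.adj_getVert_succ (hlen.symm ▸ i.2)
  · induction e with | h a b
    simp only [Set.mem_ofPred_eq, w.mk_mem_edges_iff_exists, hlen, Set.mem_range, u_finRotate,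
      Fin.exists_iff, u, Equiv.ofBijective_apply, exists_prop]

theorem cycleGraph_adj_iff_eq_finRotate {n : ℕ} {i j : Fin (n + 2)} :
    (SimpleGraph.cycleGraph (n + 2)).Adj i j ↔ j = finRotate _ i ∨ i = finRotate _ j := by
  rw [SimpleGraph.cycleGraph_adj, sub_eq_iff_eq_add', sub_eq_iff_eq_add', finRotate_apply,
    finRotate_apply, or_comm]

theorem exists_isHamiltonianCycle_of_equiv {n : ℕ} (u : Fin (n + 3) ≃ V)
    (hu : ∀ i, G.Adj (u i) (u (finRotate _ i))) :
    ∃ (v : V) (w : G.Walk v v), w.IsHamiltonianCycle ∧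
      (Set.range fun i => s(u i, u (finRotate _ i))) = {e | e ∈ w.edges} := by
  have := Fintype.ofEquiv _ u
  set f : SimpleGraph.cycleGraph (n + 3) →g G :=
    ⟨u, fun {i j} hij => by
      obtain rfl | rfl := cycleGraph_adj_iff_eq_finRotate.1 hij
      exacts [hu i, (hu j).symm]⟩
  set w := (SimpleGraph.cycleGraph.cycle n).map f
  have hlen : w.length = n + 3 := by simp [w]
  have hcycle : w.IsCycle := SimpleGraph.cycleGraph.isCycle_cycle.map u.injective
  have hw : w.IsHamiltonianCycle := by
    rw [SimpleGraph.Walk.isHamiltonianCycle_iff_isCycle_and_length_eq, hlen]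
    exact ⟨hcycle, by simp [← Fintype.card_congr u]⟩
  have edges_subset : {e | e ∈ w.edges} ⊆ Set.range fun i => s(u i, u (finRotate _ i)) := by
    intro e he
    rw [Set.mem_ofPred_eq, SimpleGraph.Walk.edges_map, List.mem_map] at he
    obtain ⟨⟨i, j⟩, hij, rfl⟩ := he
    obtain rfl | rfl := cycleGraph_adj_iff_eq_finRotate.1 (SimpleGraph.Walk.adj_of_mem_edges _ hij)
    exacts [⟨i, rfl⟩, ⟨j, Sym2.eq_swap⟩]
  have ncard_edges : {e | e ∈ w.edges}.ncard = n + 3 := by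
    rw [← List.coe_toFinset, Set.ncard_coe_finset,
      List.toFinset_card_of_nodup hcycle.isTrail.edges_nodup, w.length_edges, hlen]
  have ncard_range_le : (Set.range fun i => s(u i, u (finRotate _ i))).ncard ≤ n + 3 :=
    (Finite.card_range_le _).trans_eq (Nat.card_fin _)
  exact ⟨_, w, hw, (Set.eq_of_subset_of_ncard_le edges_subset
    (ncard_range_le.trans_eq ncard_edges.symm) (Set.finite_range _)).symm⟩

theorem hamiltonianCycles_eq_image [Fintype V] (hcard : 3 ≤ Fintype.card V) :
    hamiltonianCycles G = permEdges '' hamiltonianPerms G.Adj := by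
  refine .trans ?_ (setOf_exists_finRotate_eq_image G.Adj fun v w => s(v, w))
  ext E
  constructor
  · rintro ⟨v, w, hw, rfl⟩
    exact exists_equiv_of_isHamiltonianCycle hw
  · rintro ⟨u, hu, rfl⟩
    obtain ⟨n, hn⟩ := Nat.exists_eq_add_of_le' hcard
    revert u
    rw [hn]
    exact fun u hu => exists_isHamiltonianCycle_of_equiv u hu

theorem two_mul_numHamiltonianCycles [Fintype V] (hcard : 3 ≤ Fintype.card V)
    (G : SimpleGraph V) : 2 * numHamiltonianCycles G = (hamiltonianPerms G.Adj).ncard := by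
  classical
  have card_fiber (E) (hE : E ∈ (hamiltonianPerms G.Adj).toFinset.image permEdges) :
      {ρ ∈ (hamiltonianPerms G.Adj).toFinset | permEdges ρ = E}.card = 2 := by
    obtain ⟨π, hπG, rfl⟩ := Finset.mem_image.1 hE
    obtain ⟨hπ, hadj⟩ := Set.mem_toFinset.1 hπG
    have inv_mem : π⁻¹ ∈ hamiltonianPerms G.Adj :=
      ⟨hπ.inv, fun v => by simpa using (hadj (π⁻¹ v)).symm⟩
    have ne_inv : π ≠ π⁻¹ := fun h => by
      obtain ⟨v⟩ : Nonempty V := Fintype.card_pos_iff.1 (by omega)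
      exact apply_apply_ne_of_isCycleOn_univ hπ hcard v
        (Perm.eq_inv_iff_eq.1 (congrArg (· v) h))
    rw [← Finset.card_pair ne_inv]
    congr 1
    ext ρ
    rw [Finset.mem_filter, Set.mem_toFinset, eq_comm, permEdges_eq_iff hcard hπ,
      Finset.mem_insert, Finset.mem_singleton, and_iff_right_iff_imp]
    rintro (rfl | rfl)
    exacts [⟨hπ, hadj⟩, inv_mem]
  rw [numHamiltonianCycles, hamiltonianCycles_eq_image hcard, Set.ncard_eq_toFinset_card',
    Set.ncard_eq_toFinset_card', Set.toFinset_image,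
    Finset.card_eq_sum_card_image permEdges (hamiltonianPerms G.Adj).toFinset,
    Finset.sum_const_nat card_fiber, mul_comm]

end SimpleGraphCycles

end HamiltonianEnumeration

theorem mainTheorem3 {V : Type*} [Fintype V] [DecidableEq V] :
    (3 ≤ Fintype.card V → ∀ (G : SimpleGraph V) [DecidableRel G.Adj],
      (HamiltonianEnumeration.numHamiltonianCycles G : ℝ) =
        1 / (2 * (Fintype.card V : ℝ)) *
          ∑ l ∈ Finset.range (Fintype.card V + 1),
            (-1 : ℝ) ^ l * HamiltonianEnumeration.detDerivSum (G.adjMatrix ℝ) l) ∧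
    (1 ≤ Fintype.card V → ∀ (G : Digraph V) [DecidableRel G.Adj], (∀ v, ¬ G.Adj v v) →
      (HamiltonianEnumeration.numDirectedHamiltonianCycles G : ℝ) =
        1 / (Fintype.card V : ℝ) *
          ∑ l ∈ Finset.range (Fintype.card V + 1),
            (-1 : ℝ) ^ l *
              HamiltonianEnumeration.detDerivSum (HamiltonianEnumeration.digraphAdjMatrix G) l) := by
  refine ⟨fun hcard G _ => ?_, fun hcard G _ hG => ?_⟩
  · have card_ne_zero : (Fintype.card V : ℝ) ≠ 0 := Nat.cast_ne_zero.2 (by omega)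
    rw [HamiltonianEnumeration.adjMatrix_eq_digraphAdjMatrix,
      HamiltonianEnumeration.alternating_sum_detDerivSum_digraphAdjMatrix ⟨G.Adj⟩ fun _ => G.irrefl,
      ← HamiltonianEnumeration.two_mul_numHamiltonianCycles hcard]
    push_cast
    field_simp
  · have card_ne_zero : (Fintype.card V : ℝ) ≠ 0 := Nat.cast_ne_zero.2 (by omega)
    rw [HamiltonianEnumeration.alternating_sum_detDerivSum_digraphAdjMatrix G hG,
      HamiltonianEnumeration.numDirectedHamiltonianCycles_eq_ncard]
    field_simp
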